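/- Let $d\ge 1$, $c_\alpha,c_\beta,\gamma>0$, $m_\alpha,m_\beta\in\mathbb R^d$, and let $\Sigma_\alpha,\Sigma_\beta\in\mathbb R^{d\times d}$ be symmetric positive definite. Put $\alpha=c_\alpha\,\mathcal N(m_\alpha,\Sigma_\alpha)$ and $\beta=c_\beta\,\mathcal N(m_\beta,\Sigma_\beta)$. For finite nonnegative measures $\mu,\nu$ on $\mathbb R^d$ let $$\mathrm{KL}(\mu\,\|\,\nu)=\int\log\frac{d\mu}{d\nu}\,d\mu-\int d\mu+\int d\nu\ \in[0,+\infty]\quad\text{if }\mu\ll\nu,\qquad \mathrm{KL}(\mu\,\|\,\nu)=+\infty\ \text{ otherwise.}$$ For a finite nonnegative Borel measure $\pi$ on $\mathbb R^d\times\mathbb R^d$ with finite second moment and with first and second marginals $\pi_1,\pi_2$, define $$J_1(\pi)=\int\|x_2-x_1\|^2\,d\pi(x_1,x_2)+\gamma\,\mathrm{KL}(\pi_1\,\|\,\alpha)+\gamma\,\mathrm{KL}(\pi_2\,\|\,\beta)\in[0,+\infty].$$ **Theorem (Optimality of Gaussian).** Let $\pi$ be such a measure, with total mass $c>0$, and for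 $i=1,2$ let $m_i$ and $\Sigma_i$ be the mean and the covariance matrix of the normalized marginal $\pi_i/c$. Put $\pi_i^G=c\,\mathcal N(m_i,\Sigma_i)$, and let $\pi^G$ be the image of $\pi_1^G$ under $x\mapsto(x,\,Tx+\tau)$, where $$T=\Sigma_1^{-1/2}\bigl(\Sigma_1^{1/2}\Sigma_2\Sigma_1^{1/2}\bigr)^{1/2}\Sigma_1^{-1/2},\qquad \tau=m_2-Tm_1 ,$$ with the convention $\Sigma_1^{-1/2}:=0$ if $\Sigma_1$ is singular (by (i), this convention plays a role only if $J_1(\pi)=+\infty$). Then: (i) if $J_1(\pi)<+\infty$, then $\Sigma_1$ and $\Sigma_2$ are positive definite; (ii) if $\Sigma_1$ is positive definite, then $\pi^G$ is a finite measure with finite second moment and is a coupling of $\pi_1^G$ and $\pi_2^G$, i.e. its marginals are $\pi_1^G$ and $\pi_2^G$; (iii) $J_1(\pi^G)\le J_1(\pi)$; (iv) equality holds in (iii) if $\pi_i=c\,\mathcal N(m_i,\Sigma_i)$ for $i=1,2$ and $\pi$ is the affine Gaussian coupling between these marginals, i.e. $\pi=\pi^G$. -/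

import Mathlib

open MeasureTheory ProbabilityTheory InformationTheory
open scoped NNReal ENNReal MatrixOrder

noncomputable section

namespace GaussianUOT

/-- The `d`-dimensional Euclidean space. -/
abbrev Space (d : ℕ) : Type := EuclideanSpace ℝ (Fin d)

/-- `μ ∈ M₂⁺(E)`: a finite nonnegative measure with finite second moment. For a product
`E = ℝᵈ × ℝᵈ` the norm used is the maximum norm, which is equivalent to the Euclidean one and
so yields the same class of measures. -/
structure FiniteSecondMoment {E : Type*} [NormedAddCommGroup E] [MeasurableSpace E]
    (μ : Measure E) : Prop where
  finite : IsFiniteMeasure μ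
  memLp : MemLp (fun x : E => x) 2 μ

/-- The normalization `μ / μ(E)` of a finite nonzero measure. -/
def normalized {E : Type*} [MeasurableSpace E] (μ : Measure E) : Measure E :=
  (μ Set.univ)⁻¹ • μ

/-- The mean vector of a probability measure on `ℝᵈ`. -/
def meanVec {d : ℕ} (μ : Measure (Space d)) : Space d := ∫ x, x ∂μ

/-- The covariance matrix of a probability measure on `ℝᵈ`. -/
def covMatrix {d : ℕ} (μ : Measure (Space d)) : Matrix (Fin d) (Fin d) ℝ :=
  Matrix.of fun i j => cov[fun x : Space d => x i, fun x : Space d => x j; μ]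

/-- The unbalanced Gaussian measure `c 𝒩(m, S)`. -/
def scaledGaussian {d : ℕ} (c : ℝ≥0) (m : Space d) (S : Matrix (Fin d) (Fin d) ℝ) :
    Measure (Space d) :=
  c • multivariateGaussian m S

/-- The UOT objective
`J₁(π) = ∫ ‖x₂ - x₁‖² dπ(x₁, x₂) + γ KL(π₁ ‖ α) + γ KL(π₂ ‖ β)`, with values in `[0, ∞]`;
`π₁ = π.fst` and `π₂ = π.snd` are the marginals. For finite measures `μ ≪ ν` the divergence
`klDiv μ ν` is `∫ log (dμ/dν) dμ - μ(E) + ν(E)` (which may be `∞`), and it is `∞` if `μ` is not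
absolutely continuous with respect to `ν`. -/
def uotObjective {d : ℕ} (γ : ℝ≥0) (α β : Measure (Space d)) (π : Measure (Space d × Space d)) :
    ℝ≥0∞ :=
  (∫⁻ p, ‖p.2 - p.1‖ₑ ^ 2 ∂π) + γ * klDiv π.fst α + γ * klDiv π.snd β

/-- The matrix `T = S₁^{-1/2} (S₁^{1/2} S₂ S₁^{1/2})^{1/2} S₁^{-1/2}`
(positive semidefinite square roots; meant for positive definite `S₁`). -/
def transportMatrix {d : ℕ} (S₁ S₂ : Matrix (Fin d) (Fin d) ℝ) : Matrix (Fin d) (Fin d) ℝ :=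
  (CFC.sqrt S₁)⁻¹ * CFC.sqrt (CFC.sqrt S₁ * S₂ * CFC.sqrt S₁) * (CFC.sqrt S₁)⁻¹

/-- The affine map `x ↦ T x + τ` with `T` the transport matrix and `τ = m₂ - T m₁`. -/
def transportMap {d : ℕ} (m₁ : Space d) (S₁ : Matrix (Fin d) (Fin d) ℝ)
    (m₂ : Space d) (S₂ : Matrix (Fin d) (Fin d) ℝ) (x : Space d) : Space d :=
  Matrix.toEuclideanCLM (𝕜 := ℝ) (transportMatrix S₁ S₂) x +
    (m₂ - Matrix.toEuclideanCLM (𝕜 := ℝ) (transportMatrix S₁ S₂) m₁)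

/-- The plan induced by the affine map: the image of `c 𝒩(m₁, S₁)` under `x ↦ (x, T x + τ)`. -/
def affineGaussianCoupling {d : ℕ} (c : ℝ≥0) (m₁ : Space d) (S₁ : Matrix (Fin d) (Fin d) ℝ)
    (m₂ : Space d) (S₂ : Matrix (Fin d) (Fin d) ℝ) : Measure (Space d × Space d) :=
  (scaledGaussian c m₁ S₁).map fun x => (x, transportMap m₁ S₁ m₂ S₂ x)

end GaussianUOT

end

/-!
Write `g₁ = c 𝒩(m₁, S₁)` and `g₂ = c 𝒩(m₂, S₂)`. The point is that every quantity to be compared is,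
up to a nonnegative remainder, the integral of a quadratic polynomial against one of the marginals,
and such an integral depends only on mass, mean and covariance, so it is the same for `πᵢ` and `gᵢ`
(`sameMoments_scaledGaussian`).

*Entropy.* The density of `g₁` with respect to `α` is the exponential of a quadratic polynomial `r`
(`scaledGaussian_eq_withDensity`). By the chain rule,
`KL(π₁ ‖ α) = KL(π₁ ‖ g₁) + ∫ r dπ₁ + const = KL(π₁ ‖ g₁) + KL(g₁ ‖ α)`, and the first term is
nonnegative by Gibbs' inequality (`klDiv_withDensity_exp_le`, `klDiv_scaledGaussian_le`).

*Transport cost.* For `T` the transport matrix, `T S₁ T = S₂`, so the affine map sends `g₁` to `g₂`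
(`map_transportMap_multivariateGaussian`). With `R = T^{1/2}`, the cost `‖y - x‖²` is the sum of
quadratic potentials `φ x + ψ y` and of `‖R x - R⁻¹ (y - τ)‖²`, which vanishes on the graph of the
affine map (`exists_quadratic_potentials`). Integrating against `π` and against the affine coupling
compares the two costs (`lintegral_cost_affineGaussianCoupling_le`).

*Nondegeneracy.* If the cost is finite, the marginals are absolutely continuous; a singular
covariance would force a marginal to live on a hyperplane
(`covMatrix_posDef_of_absolutelyContinuous`).
-/

namespace GaussianUOT

/-! ### Relative entropy with respect to a measure with a log-density -/

/-- Gibbs' inequality in Pythagorean form: if `g = exp(r) α` has the mass of `μ` and the integral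
of the log-density `r` is the same under `μ` and `g`, then `KL(μ ‖ α) = KL(μ ‖ g) + KL(g ‖ α)`,
hence `KL(g ‖ α) ≤ KL(μ ‖ α)`. -/
theorem klDiv_withDensity_exp_le {E : Type*} [MeasurableSpace E] {μ g α : Measure E}
    [IsFiniteMeasure μ] [IsFiniteMeasure g] [IsFiniteMeasure α] {r : E → ℝ} (hr : Measurable r)
    (hg : g = α.withDensity fun x => ENNReal.ofReal (Real.exp (r x)))
    (hμr : Integrable r μ) (hgr : Integrable r g) (hint : ∫ x, r x ∂μ = ∫ x, r x ∂g)
    (hmass : μ Set.univ = g Set.univ) :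
    klDiv g α ≤ klDiv μ α := by
  by_cases h : klDiv μ α = ∞
  · simp [h]
  obtain ⟨hμα, hμi⟩ := klDiv_ne_top_iff.1 h
  have hm : Measurable fun x => ENNReal.ofReal (Real.exp (r x)) := by fun_prop
  have h0 : ∀ x, ENNReal.ofReal (Real.exp (r x)) ≠ 0 := fun x => by
    simp [Real.exp_pos]
  have hgα : g ≪ α := hg ▸ withDensity_absolutelyContinuous _ _
  have hαg : α ≪ g :=
    hg ▸ withDensity_absolutelyContinuous' hm.aemeasurable (ae_of_all _ h0)
  have hllrg : llr g α =ᵐ[g] r := by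
    have := Measure.rnDeriv_withDensity α hm
    rw [← hg] at this
    filter_upwards [hgα.ae_le this] with x hx
    rw [llr, hx, ENNReal.toReal_ofReal (Real.exp_pos _).le, Real.log_exp]
  -- chain rule for densities, taken on the set of full `μ`-measure where `dμ/dα` is in `(0, ∞)`
  have hllrμ : llr μ g =ᵐ[μ] fun x => llr μ α x - r x := by
    have := Measure.rnDeriv_withDensity_right μ α hm.aemeasurable (ae_of_all _ h0)
      (ae_of_all _ fun x => ENNReal.ofReal_ne_top)
    rw [← hg] at this
    filter_upwards [hμα.ae_le this, Measure.rnDeriv_pos hμα,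
      hμα.ae_le (Measure.rnDeriv_lt_top μ α)] with x hx hpos hlt
    rw [llr, hx, ENNReal.toReal_mul, ENNReal.toReal_inv,
      ENNReal.toReal_ofReal (Real.exp_pos _).le, Real.log_mul (by positivity)
        (ENNReal.toReal_pos hpos.ne' hlt.ne).ne', Real.log_inv, Real.log_exp, llr]
    ring
  have hμg : Integrable (llr μ g) μ := (hμi.sub hμr).congr hllrμ.symm
  have hnn := integral_llr_add_sub_measure_univ_nonneg (hμα.trans hαg) hμg
  rw [integral_congr_ae hllrμ, integral_sub hμi hμr] at hnn
  have hm' : μ.real Set.univ = g.real Set.univ := by simp [measureReal_def, hmass]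
  rw [klDiv_of_ac_of_integrable hμα hμi,
    klDiv_of_ac_of_integrable hgα (hgr.congr hllrg.symm), integral_congr_ae hllrg]
  apply ENNReal.ofReal_le_ofReal
  linarith

/-! ### Density of a Gaussian measure -/

/-- The standard Gaussian measure has density `exp(k - ‖x‖² / 2)` with `k = - (d / 2) log (2π)`: the
two measures have the same characteristic function. -/
theorem stdGaussian_eq_withDensity (d : ℕ) : ∃ k : ℝ,
    stdGaussian (Space d) =
      volume.withDensity fun x => ENNReal.ofReal (Real.exp (k - ‖x‖ ^ 2 / 2)) := by
  set Z : ℝ := (2 * Real.pi) ^ ((d : ℝ) / 2) with hZ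
  have hZpos : 0 < Z := by positivity
  refine ⟨-Real.log Z, ?_⟩
  have hb : (0 : ℝ) < ((1 / 2 : ℂ)).re := by norm_num
  have hexp : ∀ x : Space d, Real.exp (-Real.log Z - ‖x‖ ^ 2 / 2) =
      Z⁻¹ * Real.exp (-(‖x‖ ^ 2 / 2)) := fun x => by
    rw [sub_eq_add_neg, Real.exp_add, Real.exp_neg (Real.log Z), Real.exp_log hZpos]
  have hint : Integrable fun x : Space d => Real.exp (-Real.log Z - ‖x‖ ^ 2 / 2) := by
    simp_rw [hexp]
    refine Integrable.const_mul ?_ _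
    have := (GaussianFourier.integrable_cexp_neg_mul_sq_norm_add hb 0 (0 : Space d)).norm
    refine this.congr (ae_of_all _ fun x => ?_)
    simp only [Complex.norm_exp]
    congr 1
    simp [← Complex.ofReal_pow]
    ring
  have : IsFiniteMeasure (volume.withDensity fun x : Space d =>
      ENNReal.ofReal (Real.exp (-Real.log Z - ‖x‖ ^ 2 / 2))) :=
    isFiniteMeasure_withDensity_ofReal hint.2
  apply Measure.ext_of_charFun
  ext t
  rw [charFun_stdGaussian, charFun_apply, integral_withDensity_eq_integral_toReal_smul (by fun_prop)
    (ae_of_all _ fun x => ENNReal.ofReal_lt_top)]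
  have key := GaussianFourier.integral_cexp_neg_mul_sq_norm_add hb Complex.I t
  have hfun : (fun x : Space d => (ENNReal.ofReal (Real.exp (-Real.log Z - ‖x‖ ^ 2 / 2))).toReal •
      Complex.exp (inner ℝ x t * Complex.I)) = fun x => (Z⁻¹ : ℂ) *
        Complex.exp (-(1 / 2 : ℂ) * ‖x‖ ^ 2 + Complex.I * inner ℝ t x) := by
    ext x
    rw [ENNReal.toReal_ofReal (Real.exp_pos _).le, hexp, Complex.real_smul, Complex.exp_add,
      real_inner_comm]
    push_cast
    rw [mul_assoc]
    congr 3
    · ring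
    · ring_nf
  rw [hfun, integral_const_mul, key]
  have hpow : ((Real.pi : ℂ) / (1 / 2)) ^ (Module.finrank ℝ (Space d) / 2 : ℂ) = (Z : ℂ) := by
    rw [hZ, Complex.ofReal_cpow (by positivity)]
    simp
    ring_nf
  rw [hpow, ← mul_assoc, inv_mul_cancel₀ (by exact_mod_cast hZpos.ne'), one_mul]
  congr 1
  simp
  ring

theorem posDef_sqrt {n : Type*} [Fintype n] [DecidableEq n] {S : Matrix n n ℝ} (hS : S.PosDef) :
    (CFC.sqrt S).PosDef := by
  have h : (CFC.sqrt S).PosSemidef := Matrix.nonneg_iff_posSemidef.1 (CFC.sqrt_nonneg S)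
  rw [h.posDef_iff_det_ne_zero]
  intro h0
  have := hS.det_pos
  rw [← CFC.sqrt_mul_sqrt_self S hS.posSemidef.nonneg, Matrix.det_mul, h0] at this
  simp at this

theorem toEuclideanCLM_mul_apply {n : Type*} [Fintype n] [DecidableEq n] (A B : Matrix n n ℝ)
    (x : EuclideanSpace ℝ n) :
    Matrix.toEuclideanCLM (𝕜 := ℝ) (A * B) x =
      Matrix.toEuclideanCLM (𝕜 := ℝ) A (Matrix.toEuclideanCLM (𝕜 := ℝ) B x) := by
  rw [map_mul]; rfl

theorem toEuclideanCLM_one_apply {n : Type*} [Fintype n] [DecidableEq n]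
    (x : EuclideanSpace ℝ n) :
    Matrix.toEuclideanCLM (𝕜 := ℝ) (1 : Matrix n n ℝ) x = x := by
  rw [map_one]; rfl

/-- A nondegenerate Gaussian measure has a density whose logarithm is a constant minus the squared
norm of an affine function. -/
theorem scaledGaussian_eq_withDensity {d : ℕ} {c : ℝ≥0} (hc : 0 < c) (m : Space d)
    {S : Matrix (Fin d) (Fin d) ℝ} (hS : S.PosDef) :
    ∃ (k : ℝ) (L : Space d →L[ℝ] Space d) (b : Space d), scaledGaussian c m S =
      volume.withDensity fun x => ENNReal.ofReal (Real.exp (k - ‖L x + b‖ ^ 2 / 2)) := by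
  obtain ⟨k, hk⟩ := stdGaussian_eq_withDensity d
  set A := CFC.sqrt S
  have hA : IsUnit A.det := (Matrix.isUnit_iff_isUnit_det _).1 (posDef_sqrt hS).isUnit
  set F := Matrix.toEuclideanCLM (𝕜 := ℝ) A with hF
  set G := Matrix.toEuclideanCLM (𝕜 := ℝ) A⁻¹ with hG
  have hFG : ∀ x, F (G x) = x := fun x => by
    rw [hF, hG, ← toEuclideanCLM_mul_apply, Matrix.mul_nonsing_inv _ hA,
      toEuclideanCLM_one_apply]
  have hGF : ∀ x, G (F x) = x := fun x => by
    rw [hF, hG, ← toEuclideanCLM_mul_apply, Matrix.nonsing_inv_mul _ hA,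
      toEuclideanCLM_one_apply]
  have hdet : LinearMap.det (F : Space d →ₗ[ℝ] Space d) ≠ 0 := by
    have h1 : (F : Space d →ₗ[ℝ] Space d) ∘ₗ (G : Space d →ₗ[ℝ] Space d) = LinearMap.id :=
      LinearMap.ext hFG
    intro h0
    have h2 := congrArg LinearMap.det h1
    rw [LinearMap.det_comp, h0, LinearMap.det_id] at h2
    simp at h2
  set D := |(LinearMap.det (F : Space d →ₗ[ℝ] Space d))⁻¹| with hD
  have hDpos : 0 < D := abs_pos.2 (inv_ne_zero hdet)
  have hvol : (volume : Measure (Space d)).map (fun x => m + F x) = ENNReal.ofReal D • volume := by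
    have h1 : (fun x => m + F x) = (fun x => m + x) ∘ ⇑(F : Space d →ₗ[ℝ] Space d) := rfl
    have hF' : Measurable ⇑(F : Space d →ₗ[ℝ] Space d) := F.continuous.measurable
    rw [h1, ← Measure.map_map (measurable_const_add m) hF',
      Measure.map_linearMap_addHaar_eq_smul_addHaar _ hdet, Measure.map_smul, map_add_left_eq_self]
  -- the constant collects the mass `c` and the Jacobian factor `D` of the change of variables
  refine ⟨Real.log c + Real.log D + k, G, -G m, ?_⟩
  ext s hs
  have hmeas : Measurable fun x => m + F x := by fun_prop
  rw [scaledGaussian, multivariateGaussian, hk, Measure.smul_apply, Measure.map_apply hmeas hs,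
    withDensity_apply _ (hmeas hs), withDensity_apply _ hs]
  let f : Space d → ℝ≥0∞ := fun y => ENNReal.ofReal (Real.exp (k - ‖G y + -G m‖ ^ 2 / 2))
  have hf : Measurable f := by fun_prop
  have h2 : ∀ x, ENNReal.ofReal (Real.exp (k - ‖x‖ ^ 2 / 2)) =
      f (m + F x) := fun x => by
    simp [f, hGF]
  rw [lintegral_congr h2, ← setLIntegral_map hs hf hmeas, hvol, Measure.restrict_smul,
    lintegral_smul_measure, smul_eq_mul, ENNReal.smul_def, smul_eq_mul, ← mul_assoc,
    ← lintegral_const_mul _ (by fun_prop)]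
  congr 1
  ext x
  rw [← ENNReal.ofReal_coe_nnreal, ← ENNReal.ofReal_mul (by positivity),
    ← ENNReal.ofReal_mul (by positivity)]
  congr 1
  rw [add_sub_assoc, Real.exp_add, Real.exp_add, Real.exp_log (by exact_mod_cast hc),
    Real.exp_log hDpos]

/-! ### Moments of order at most two -/

/-- `f` is integrable for both measures, with the same integral. -/
structure IntegralsAgree {E : Type*} [MeasurableSpace E] (μ ν : Measure E) (f : E → ℝ) : Prop where
  left : Integrable f μ
  right : Integrable f ν
  eq : ∫ x, f x ∂μ = ∫ x, f x ∂ν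

namespace IntegralsAgree

variable {E : Type*} [MeasurableSpace E] {μ ν : Measure E} {f g : E → ℝ}

theorem add (hf : IntegralsAgree μ ν f) (hg : IntegralsAgree μ ν g) :
    IntegralsAgree μ ν fun x => f x + g x where
  left := hf.left.add hg.left
  right := hf.right.add hg.right
  eq := by
    rw [integral_add hf.left hg.left, integral_add hf.right hg.right, hf.eq, hg.eq]

theorem sub (hf : IntegralsAgree μ ν f) (hg : IntegralsAgree μ ν g) :
    IntegralsAgree μ ν fun x => f x - g x where
  left := hf.left.sub hg.left
  right := hf.right.sub hg.right
  eq := by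
    rw [integral_sub hf.left hg.left, integral_sub hf.right hg.right, hf.eq, hg.eq]

theorem div_const (hf : IntegralsAgree μ ν f) (a : ℝ) : IntegralsAgree μ ν fun x => f x / a where
  left := hf.left.div_const a
  right := hf.right.div_const a
  eq := by rw [integral_div, integral_div, hf.eq]

theorem const [IsFiniteMeasure μ] [IsFiniteMeasure ν] (h : μ Set.univ = ν Set.univ) (a : ℝ) :
    IntegralsAgree μ ν fun _ => a where
  left := integrable_const a
  right := integrable_const a
  eq := by simp [measureReal_def, h]

theorem smul_measure (hf : IntegralsAgree μ ν f) (c : ℝ≥0) :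
    IntegralsAgree (c • μ) (c • ν) f where
  left := hf.left.smul_measure_nnreal
  right := hf.right.smul_measure_nnreal
  eq := by rw [integral_smul_nnreal_measure, integral_smul_nnreal_measure, hf.eq]

end IntegralsAgree

/-- Two finite measures have the same mass, and give the same integrals to squared norms of affine
functions (by polarization, this amounts to equality of all moments of order at most two). -/
structure SameMoments {d : ℕ} (μ ν : Measure (Space d)) : Prop where
  mass : μ Set.univ = ν Set.univ
  affine (L : Space d →L[ℝ] Space d) (b : Space d) : IntegralsAgree μ ν fun x => ‖L x + b‖ ^ 2

theorem covarianceBilin_eq_covMatrix {d : ℕ} {P : Measure (Space d)} [IsProbabilityMeasure P]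
    (hP : MemLp id 2 P) (u v : Space d) :
    covarianceBilin P u v = u ⬝ᵥ (covMatrix P).mulVec v := by
  have h := covarianceBilin_apply_pi (μ := P) (X := fun i x => x i)
    (fun i => (EuclideanSpace.proj (𝕜 := ℝ) i).comp_memLp' hP) u v
  have hid : P.map (fun x : Space d => WithLp.toLp 2 fun i => x i) = P := Measure.map_id
  rw [hid] at h
  rw [h]
  simp only [covMatrix, dotProduct, Matrix.mulVec, Matrix.of_apply, Finset.mul_sum]
  refine Finset.sum_congr rfl fun i _ => Finset.sum_congr rfl fun j _ => ?_
  ring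

theorem covMatrix_posSemidef {d : ℕ} {P : Measure (Space d)} [IsProbabilityMeasure P]
    (hP : MemLp id 2 P) : (covMatrix P).PosSemidef := by
  refine Matrix.PosSemidef.of_dotProduct_mulVec_nonneg ?_ fun x => ?_
  · ext i j
    simp [covMatrix, covariance_comm]
  · have := covarianceBilin_eq_covMatrix hP (WithLp.toLp 2 x) (WithLp.toLp 2 x)
    simp [← this, covarianceBilin_self_nonneg]

theorem covMatrix_multivariateGaussian {d : ℕ} (m : Space d) {S : Matrix (Fin d) (Fin d) ℝ}
    (hS : S.PosSemidef) : covMatrix (multivariateGaussian m S) = S := by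
  ext i j
  exact covariance_eval_multivariateGaussian hS i j

/-- The second moment of an affine function is its variance plus the square of its mean, hence is
determined by the mean vector and the covariance matrix. -/
theorem integral_inner_add_sq {d : ℕ} {P : Measure (Space d)} [IsProbabilityMeasure P]
    (hP : MemLp id 2 P) (u : Space d) (t : ℝ) :
    Integrable (fun x => (inner ℝ u x + t) ^ 2) P ∧
      ∫ x, (inner ℝ u x + t) ^ 2 ∂P =
        u ⬝ᵥ (covMatrix P).mulVec u + (inner ℝ u (meanVec P) + t) ^ 2 := by
  have h1 : MemLp (fun x => inner ℝ u x) 2 P := hP.const_inner u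
  have h2 : MemLp (fun x => inner ℝ u x + t) 2 P := h1.add (memLp_const t)
  have hi : Integrable (fun x : Space d => x) P := hP.integrable (by norm_num)
  refine ⟨h2.integrable_sq, ?_⟩
  have hvar := variance_eq_sub h2
  rw [variance_add_const h1.aestronglyMeasurable, ← covarianceBilin_self hP,
    covarianceBilin_eq_covMatrix hP] at hvar
  have hmean : ∫ x, (inner ℝ u x + t) ∂P = inner ℝ u (meanVec P) + t := by
    rw [integral_add (h1.integrable (by norm_num)) (integrable_const t), integral_inner hi]
    simp [meanVec]
  rw [hmean] at hvar
  simp only [Pi.pow_apply] at hvar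
  linarith

/-- Expand the squared norm in coordinates: each coordinate of `L x + b` is an affine function. -/
theorem integralsAgree_norm_sq {d : ℕ} {P Q : Measure (Space d)} [IsProbabilityMeasure P]
    [IsProbabilityMeasure Q] (hP : MemLp id 2 P) (hQ : MemLp id 2 Q)
    (hmean : meanVec P = meanVec Q) (hcov : covMatrix P = covMatrix Q)
    (L : Space d →L[ℝ] Space d) (b : Space d) :
    IntegralsAgree P Q fun x => ‖L x + b‖ ^ 2 := by
  have h : ∀ x, ‖L x + b‖ ^ 2 =
      ∑ i, (inner ℝ (L.adjoint (EuclideanSpace.basisFun (Fin d) ℝ i)) x + b i) ^ 2 := fun x => by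
    simp [EuclideanSpace.real_norm_sq_eq, EuclideanSpace.inner_single_left,
      ContinuousLinearMap.adjoint_inner_left]
  simp_rw [h]
  refine ⟨integrable_finsetSum _ fun i _ => (integral_inner_add_sq hP _ _).1,
    integrable_finsetSum _ fun i _ => (integral_inner_add_sq hQ _ _).1, ?_⟩
  rw [integral_finsetSum _ fun i _ => (integral_inner_add_sq hP _ _).1,
    integral_finsetSum _ fun i _ => (integral_inner_add_sq hQ _ _).1]
  refine Finset.sum_congr rfl fun i _ => ?_
  rw [(integral_inner_add_sq hP _ _).2, (integral_inner_add_sq hQ _ _).2, hmean, hcov]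

section normalized

variable {E : Type*} [MeasurableSpace E] {μ : Measure E} {c : ℝ≥0}

theorem isProbabilityMeasure_normalized (hc : 0 < c) (hmass : μ Set.univ = c) :
    IsProbabilityMeasure (normalized μ) := ⟨by
  rw [normalized, Measure.smul_apply, hmass, smul_eq_mul]
  exact ENNReal.inv_mul_cancel (by simpa using hc.ne') ENNReal.coe_ne_top⟩

theorem smul_normalized (hc : 0 < c) (hmass : μ Set.univ = c) : c • normalized μ = μ := by
  rw [normalized, hmass, ← Measure.coe_nnreal_smul, smul_smul,
    ENNReal.mul_inv_cancel (by simpa using hc.ne') ENNReal.coe_ne_top, one_smul]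

theorem FiniteSecondMoment.memLp_normalized [NormedAddCommGroup E] (hμ : FiniteSecondMoment μ)
    (hc : 0 < c) (hmass : μ Set.univ = c) : MemLp id 2 (normalized μ) :=
  hμ.memLp.smul_measure (by simpa [hmass] using hc.ne')

end normalized

/-- The measure `c 𝒩(m, S)`, with `m` and `S` the mean and covariance of the normalization of `μ`,
has the same mass, mean and covariance as `μ`. -/
theorem sameMoments_scaledGaussian {d : ℕ} {μ : Measure (Space d)} {c : ℝ≥0}
    (hμ : FiniteSecondMoment μ) (hc : 0 < c) (hmass : μ Set.univ = c) :
    SameMoments μ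
      (scaledGaussian c (meanVec (normalized μ)) (covMatrix (normalized μ))) := by
  have := isProbabilityMeasure_normalized hc hmass
  have hP := hμ.memLp_normalized hc hmass
  refine ⟨by simp [scaledGaussian, hmass], fun L b => ?_⟩
  have h := (integralsAgree_norm_sq hP IsGaussian.memLp_two_id
    integral_id_multivariateGaussian.symm
    (covMatrix_multivariateGaussian _ (covMatrix_posSemidef hP)).symm L b).smul_measure c
  rwa [smul_normalized hc hmass] at h

/-- A hyperplane is Lebesgue-null, whereas a measure with singular covariance is concentrated on a
hyperplane. -/
theorem covMatrix_posDef_of_absolutelyContinuous {d : ℕ} {μ : Measure (Space d)} {c : ℝ≥0}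
    (hμ : FiniteSecondMoment μ) (hc : 0 < c) (hmass : μ Set.univ = c)
    (hac : μ ≪ volume) : (covMatrix (normalized μ)).PosDef := by
  have := isProbabilityMeasure_normalized hc hmass
  have hP := hμ.memLp_normalized hc hmass
  have hS := covMatrix_posSemidef hP
  set P := normalized μ with hPdef
  have hPac : P ≪ volume := hac.smul_left _
  refine Matrix.PosDef.of_dotProduct_mulVec_pos hS.1 fun v hv => ?_
  refine lt_of_le_of_ne (hS.dotProduct_mulVec_nonneg v) fun h0 => ?_
  set u : Space d := WithLp.toLp 2 v with hu
  have hu0 : u ≠ 0 := by simpa [hu] using hv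
  have hvar : Var[fun x => inner ℝ u x; P] = 0 := by
    rw [← covarianceBilin_self hP, covarianceBilin_eq_covMatrix hP]
    simpa [hu] using h0.symm
  have h1 : MemLp (fun x => inner ℝ u x) 2 P := hP.const_inner u
  have hae := ae_eq_integral_of_variance_eq_zero h1 hvar
  set a := ∫ x, inner ℝ u x ∂P
  -- the hyperplane `⟪u, x⟫ = a`, as the preimage of the point `a`
  set H : AffineSubspace ℝ (Space d) :=
    (AffineSubspace.mk' a (⊥ : Submodule ℝ ℝ)).comap (innerSL ℝ u).toLinearMap.toAffineMap with hH
  have hmem : ∀ x, x ∈ H ↔ inner ℝ u x = a := fun x => by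
    simp [hH, AffineSubspace.mem_comap, AffineSubspace.mem_mk', sub_eq_zero]
  have hHtop : H ≠ ⊤ := fun htop => by
    have h2 := (hmem 0).1 (htop ▸ AffineSubspace.mem_top ℝ _ _)
    have h3 := (hmem u).1 (htop ▸ AffineSubspace.mem_top ℝ _ _)
    rw [← h2, inner_zero_right, inner_self_eq_zero] at h3
    exact hu0 h3
  have hnull : P (H : Set (Space d)) = 0 := hPac (Measure.addHaar_affineSubspace volume H hHtop)
  have hfull : ∀ᵐ x ∂P, x ∈ (H : Set (Space d)) := by
    filter_upwards [hae] with x hx using (hmem x).2 hx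
  have hfull' : P (H : Set (Space d))ᶜ = 0 := hfull
  have := measure_univ_le_add_compl (μ := P) (H : Set (Space d))
  simp [hnull, hfull'] at this

instance isFiniteMeasure_scaledGaussian {d : ℕ} (c : ℝ≥0) (m : Space d)
    (S : Matrix (Fin d) (Fin d) ℝ) : IsFiniteMeasure (scaledGaussian c m S) := by
  unfold scaledGaussian; infer_instance

/-- Among the measures with prescribed mass, mean and covariance, the Gaussian one minimizes the
relative entropy with respect to a nondegenerate Gaussian measure. -/
theorem klDiv_scaledGaussian_le {d : ℕ} {μ : Measure (Space d)} [IsFiniteMeasure μ]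
    {c cα : ℝ≥0} (hc : 0 < c) (hcα : 0 < cα) {m mα : Space d} {S Sα : Matrix (Fin d) (Fin d) ℝ}
    (hS : S.PosDef) (hSα : Sα.PosDef) (h : SameMoments μ (scaledGaussian c m S)) :
    klDiv (scaledGaussian c m S) (scaledGaussian cα mα Sα) ≤
      klDiv μ (scaledGaussian cα mα Sα) := by
  obtain ⟨k, L, b, hg⟩ := scaledGaussian_eq_withDensity hc m hS
  obtain ⟨k', L', b', hα⟩ := scaledGaussian_eq_withDensity hcα mα hSα
  have hr : IntegralsAgree μ (scaledGaussian c m S)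
      fun x => (k - ‖L x + b‖ ^ 2 / 2) - (k' - ‖L' x + b'‖ ^ 2 / 2) :=
    ((IntegralsAgree.const h.mass k).sub ((h.affine L b).div_const 2)).sub
      ((IntegralsAgree.const h.mass k').sub ((h.affine L' b').div_const 2))
  refine klDiv_withDensity_exp_le (by fun_prop) ?_ hr.left hr.right hr.eq h.mass
  rw [hα, ← withDensity_mul _ (by fun_prop) (by fun_prop), hg]
  congr 1
  ext x
  rw [Pi.mul_apply, ← ENNReal.ofReal_mul (Real.exp_pos _).le, ← Real.exp_add]
  congr 2
  ring

/-! ### The transport matrix -/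

theorem transportMatrix_posSemidef {d : ℕ} {S₁ S₂ : Matrix (Fin d) (Fin d) ℝ} :
    (transportMatrix S₁ S₂).PosSemidef := by
  have h := (Matrix.nonneg_iff_posSemidef.1
    (CFC.sqrt_nonneg (CFC.sqrt S₁ * S₂ * CFC.sqrt S₁))).mul_mul_conjTranspose_same (CFC.sqrt S₁)⁻¹
  have hA : (CFC.sqrt S₁).IsHermitian :=
    (Matrix.nonneg_iff_posSemidef.1 (CFC.sqrt_nonneg S₁)).isHermitian
  rwa [hA.inv.eq] at h

theorem sqrt_mul_mul_sqrt_posSemidef {d : ℕ} {S₁ S₂ : Matrix (Fin d) (Fin d) ℝ}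
    (hS₂ : S₂.PosSemidef) : (CFC.sqrt S₁ * S₂ * CFC.sqrt S₁).PosSemidef := by
  have hA : (CFC.sqrt S₁).IsHermitian :=
    (Matrix.nonneg_iff_posSemidef.1 (CFC.sqrt_nonneg S₁)).isHermitian
  have h := hS₂.mul_mul_conjTranspose_same (CFC.sqrt S₁)
  rwa [hA.eq] at h

/-- The identity `T S₁ T = S₂`, which says that `T` carries the covariance `S₁` to `S₂`. -/
theorem transportMatrix_mul_mul {d : ℕ} {S₁ S₂ : Matrix (Fin d) (Fin d) ℝ}
    (hS₁ : S₁.PosDef) (hS₂ : S₂.PosSemidef) :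
    transportMatrix S₁ S₂ * S₁ * transportMatrix S₁ S₂ = S₂ := by
  set A := CFC.sqrt S₁ with hAdef
  have hA : IsUnit A.det := (Matrix.isUnit_iff_isUnit_det _).1 (posDef_sqrt hS₁).isUnit
  set B := CFC.sqrt (A * S₂ * A) with hBdef
  have hB : B * B = A * S₂ * A :=
    CFC.sqrt_mul_sqrt_self _ (sqrt_mul_mul_sqrt_posSemidef hS₂).nonneg
  have hAA : A * A = S₁ := CFC.sqrt_mul_sqrt_self S₁ hS₁.posSemidef.nonneg
  have hT : transportMatrix S₁ S₂ = A⁻¹ * B * A⁻¹ := rfl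
  calc transportMatrix S₁ S₂ * S₁ * transportMatrix S₁ S₂
      = A⁻¹ * B * (A⁻¹ * A) * (A * A⁻¹) * B * A⁻¹ := by
        rw [hT, ← hAA]; simp only [Matrix.mul_assoc]
    _ = A⁻¹ * (B * B) * A⁻¹ := by
        rw [Matrix.nonsing_inv_mul _ hA, Matrix.mul_nonsing_inv _ hA]
        simp only [Matrix.mul_assoc, Matrix.mul_one]
    _ = (A⁻¹ * A) * S₂ * (A * A⁻¹) := by rw [hB]; simp only [Matrix.mul_assoc]
    _ = S₂ := by
        rw [Matrix.nonsing_inv_mul _ hA, Matrix.mul_nonsing_inv _ hA, Matrix.one_mul,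
          Matrix.mul_one]

theorem transportMatrix_posDef {d : ℕ} {S₁ S₂ : Matrix (Fin d) (Fin d) ℝ}
    (hS₁ : S₁.PosDef) (hS₂ : S₂.PosDef) : (transportMatrix S₁ S₂).PosDef := by
  rw [transportMatrix_posSemidef.posDef_iff_det_ne_zero]
  intro h0
  have h := hS₂.det_pos
  rw [← transportMatrix_mul_mul hS₁ hS₂.posSemidef, Matrix.det_mul, h0] at h
  simp at h

theorem inner_toEuclideanCLM_comm {d : ℕ} {R : Matrix (Fin d) (Fin d) ℝ} (hR : R.IsHermitian)
    (x y : Space d) :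
    inner ℝ (Matrix.toEuclideanCLM (𝕜 := ℝ) R x) y =
      inner ℝ x (Matrix.toEuclideanCLM (𝕜 := ℝ) R y) := by
  have h : IsSelfAdjoint (Matrix.toEuclideanCLM (n := Fin d) (𝕜 := ℝ) R) :=
    IsSelfAdjoint.map (show IsSelfAdjoint R from hR) _
  rw [← ContinuousLinearMap.adjoint_inner_left, h.adjoint_eq]

/-! ### The affine Gaussian coupling -/

@[fun_prop]
theorem continuous_transportMap {d : ℕ} (m₁ m₂ : Space d) (S₁ S₂ : Matrix (Fin d) (Fin d) ℝ) :
    Continuous (transportMap m₁ S₁ m₂ S₂) := by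
  unfold transportMap; fun_prop

@[fun_prop]
theorem measurable_transportMap {d : ℕ} (m₁ m₂ : Space d) (S₁ S₂ : Matrix (Fin d) (Fin d) ℝ) :
    Measurable (transportMap m₁ S₁ m₂ S₂) :=
  (continuous_transportMap m₁ m₂ S₁ S₂).measurable

theorem map_transportMap_multivariateGaussian {d : ℕ} (m₁ m₂ : Space d)
    {S₁ S₂ : Matrix (Fin d) (Fin d) ℝ} (hS₁ : S₁.PosDef) (hS₂ : S₂.PosSemidef) :
    (multivariateGaussian m₁ S₁).map (transportMap m₁ S₁ m₂ S₂) = multivariateGaussian m₂ S₂ := by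
  set T := Matrix.toEuclideanCLM (𝕜 := ℝ) (transportMatrix S₁ S₂) with hT
  have hcomp : transportMap m₁ S₁ m₂ S₂ = (fun x => (m₂ - T m₁) + x) ∘ T := by
    ext1 x; simp only [transportMap, Function.comp_apply]; exact add_comm _ _
  have hsymm := transportMatrix_posSemidef (S₁ := S₁) (S₂ := S₂) |>.isHermitian
  have hmap : (multivariateGaussian m₁ S₁).map (transportMap m₁ S₁ m₂ S₂) =
      ((multivariateGaussian m₁ S₁).map T).map fun x => (m₂ - T m₁) + x := by
    rw [hcomp, Measure.map_map (measurable_const_add _) T.continuous.measurable]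
  have hadj : T.adjoint = T := by
    have h : IsSelfAdjoint T := IsSelfAdjoint.map (show IsSelfAdjoint _ from hsymm) _
    exact h.adjoint_eq
  have : IsGaussian ((multivariateGaussian m₁ S₁).map (transportMap m₁ S₁ m₂ S₂)) := by
    rw [hmap]; infer_instance
  apply IsGaussian.ext
  · rw [integral_map (by fun_prop) (by fun_prop)]
    have hTi : Integrable (fun x => T x) (multivariateGaussian m₁ S₁) :=
      T.integrable_comp IsGaussian.integrable_id
    simp only [id_eq, transportMap, integral_id_multivariateGaussian, ← hT]
    rw [integral_add hTi (integrable_const _),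
      ContinuousLinearMap.integral_comp_comm _ IsGaussian.integrable_fun_id]
    simp
  · rw [hmap, covarianceBilin_map_const_add]
    ext u v
    rw [covarianceBilin_map IsGaussian.memLp_two_id, hadj,
      covarianceBilin_multivariateGaussian hS₁.posSemidef,
      covarianceBilin_multivariateGaussian hS₂, ← Matrix.inner_toEuclideanCLM,
      ← Matrix.inner_toEuclideanCLM, hT, inner_toEuclideanCLM_comm hsymm,
      ← toEuclideanCLM_mul_apply, ← toEuclideanCLM_mul_apply,
      transportMatrix_mul_mul hS₁ hS₂]

theorem memLp_scaledGaussian {d : ℕ} (c : ℝ≥0) (m : Space d) (S : Matrix (Fin d) (Fin d) ℝ) :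
    MemLp id 2 (scaledGaussian c m S) := by
  rw [scaledGaussian, ← Measure.coe_nnreal_smul]
  exact IsGaussian.memLp_two_id.smul_measure ENNReal.coe_ne_top

theorem affineGaussianCoupling_fst {d : ℕ} (c : ℝ≥0) (m₁ m₂ : Space d)
    (S₁ S₂ : Matrix (Fin d) (Fin d) ℝ) :
    (affineGaussianCoupling c m₁ S₁ m₂ S₂).fst = scaledGaussian c m₁ S₁ := by
  rw [affineGaussianCoupling, Measure.fst, Measure.map_map measurable_fst (by fun_prop)]
  exact Measure.map_id

theorem affineGaussianCoupling_snd {d : ℕ} (c : ℝ≥0) (m₁ m₂ : Space d)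
    {S₁ S₂ : Matrix (Fin d) (Fin d) ℝ} (hS₁ : S₁.PosDef) (hS₂ : S₂.PosSemidef) :
    (affineGaussianCoupling c m₁ S₁ m₂ S₂).snd = scaledGaussian c m₂ S₂ := by
  rw [affineGaussianCoupling, Measure.snd, Measure.map_map measurable_snd (by fun_prop),
    scaledGaussian, scaledGaussian, ← map_transportMap_multivariateGaussian m₁ m₂ hS₁ hS₂,
    Measure.map_smul]
  rfl

theorem finiteSecondMoment_affineGaussianCoupling {d : ℕ} (c : ℝ≥0) (m₁ m₂ : Space d)
    (S₁ S₂ : Matrix (Fin d) (Fin d) ℝ) :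
    FiniteSecondMoment (affineGaussianCoupling c m₁ S₁ m₂ S₂) := by
  refine ⟨by unfold affineGaussianCoupling; infer_instance, ?_⟩
  rw [affineGaussianCoupling, memLp_map_measure_iff (by fun_prop) (by fun_prop)]
  have h1 := memLp_scaledGaussian c m₁ S₁
  have h2 : MemLp (transportMap m₁ S₁ m₂ S₂) 2 (scaledGaussian c m₁ S₁) :=
    ((Matrix.toEuclideanCLM (𝕜 := ℝ) (transportMatrix S₁ S₂)).comp_memLp' h1).add (memLp_const _)
  -- the norm of a pair is a maximum, bounded by the sum
  refine (h1.norm.add h2.norm).mono (by fun_prop) (ae_of_all _ fun x => ?_)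
  simp only [Function.comp_apply, Prod.norm_mk, Pi.add_apply, id_eq, Real.norm_eq_abs]
  rw [abs_of_nonneg (by positivity)]
  exact max_le_add_of_nonneg (norm_nonneg _) (norm_nonneg _)

theorem FiniteSecondMoment.fst {d : ℕ} {π : Measure (Space d × Space d)}
    (hπ : FiniteSecondMoment π) : FiniteSecondMoment π.fst := by
  have := hπ.finite
  refine ⟨inferInstance, (memLp_map_measure_iff (by fun_prop) (by fun_prop)).2 ?_⟩
  exact hπ.memLp.mono (by fun_prop) (ae_of_all _ fun p => norm_fst_le p)

theorem FiniteSecondMoment.snd {d : ℕ} {π : Measure (Space d × Space d)}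
    (hπ : FiniteSecondMoment π) : FiniteSecondMoment π.snd := by
  have := hπ.finite
  refine ⟨inferInstance, (memLp_map_measure_iff (by fun_prop) (by fun_prop)).2 ?_⟩
  exact hπ.memLp.mono (by fun_prop) (ae_of_all _ fun p => norm_snd_le p)

/-! ### Optimality of the affine coupling for the quadratic cost -/

/-- Kantorovich potentials for the affine map: with `R` the square root of the transport matrix,
the cost is a quadratic function of `x` plus a quadratic function of `y` plus the square
`‖R x - R⁻¹ (y - τ)‖²`, and the last term vanishes on the graph of the map. -/
theorem exists_quadratic_potentials {d : ℕ} (m₁ m₂ : Space d)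
    {S₁ S₂ : Matrix (Fin d) (Fin d) ℝ} (hS₁ : S₁.PosDef) (hS₂ : S₂.PosDef) :
    ∃ φ ψ : Space d → ℝ, Measurable φ ∧ Measurable ψ ∧ (∀ x y, φ x + ψ y ≤ ‖y - x‖ ^ 2) ∧
      (∀ x, φ x + ψ (transportMap m₁ S₁ m₂ S₂ x) = ‖transportMap m₁ S₁ m₂ S₂ x - x‖ ^ 2) ∧
      (∀ μ ν : Measure (Space d), IsFiniteMeasure μ → IsFiniteMeasure ν → SameMoments μ ν →
        IntegralsAgree μ ν φ ∧ IntegralsAgree μ ν ψ) := by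
  have hTpd := transportMatrix_posDef hS₁ hS₂
  set τ : Space d := m₂ - Matrix.toEuclideanCLM (𝕜 := ℝ) (transportMatrix S₁ S₂) m₁ with hτ
  set A := CFC.sqrt (transportMatrix S₁ S₂)
  have hApd : A.PosDef := posDef_sqrt hTpd
  have hA : IsUnit A.det := (Matrix.isUnit_iff_isUnit_det _).1 hApd.isUnit
  have hAA : A * A = transportMatrix S₁ S₂ := CFC.sqrt_mul_sqrt_self _ hTpd.posSemidef.nonneg
  set R := Matrix.toEuclideanCLM (𝕜 := ℝ) A with hR
  set R' := Matrix.toEuclideanCLM (𝕜 := ℝ) A⁻¹ with hR'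
  have hinner : ∀ x y, inner ℝ (R x) (R' y) = inner ℝ x y := fun x y => by
    rw [hR, hR', inner_toEuclideanCLM_comm hApd.isHermitian, ← toEuclideanCLM_mul_apply,
      Matrix.mul_nonsing_inv _ hA, toEuclideanCLM_one_apply]
  have hgraph : ∀ x, R' (transportMap m₁ S₁ m₂ S₂ x - τ) = R x := fun x => by
    rw [transportMap, ← hτ, add_sub_cancel_right, ← hAA, hR, hR', ← toEuclideanCLM_mul_apply,
      ← Matrix.mul_assoc, Matrix.nonsing_inv_mul _ hA, Matrix.one_mul]
  set φ : Space d → ℝ := fun x => ‖x + -τ‖ ^ 2 - ‖τ‖ ^ 2 - ‖R x + 0‖ ^ 2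
  set ψ : Space d → ℝ := fun y => ‖y + 0‖ ^ 2 - ‖R' y + -R' τ‖ ^ 2
  have key : ∀ x y, ‖y - x‖ ^ 2 = φ x + ψ y + ‖R x - R' (y - τ)‖ ^ 2 := fun x y => by
    simp only [φ, ψ, add_zero, ← sub_eq_add_neg, ← map_sub, norm_sub_sq_real, hinner,
      inner_sub_right]
    rw [real_inner_comm x y]
    ring
  refine ⟨φ, ψ, by fun_prop, by fun_prop, fun x y => ?_, fun x => ?_, fun μ ν _ _ h => ⟨?_, ?_⟩⟩
  · rw [key]
    exact le_add_of_nonneg_right (by positivity)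
  · rw [key, hgraph]
    simp
  · exact ((h.affine (.id ℝ _) (-τ)).sub (.const h.mass _)).sub (h.affine R 0)
  · exact (h.affine (.id ℝ _) 0).sub (h.affine R' _)

/-- Gelbrich's bound: the affine coupling of two Gaussian measures costs at most as much as any plan
whose marginals have the same moments of order at most two. -/
theorem lintegral_cost_affineGaussianCoupling_le {d : ℕ} {π : Measure (Space d × Space d)}
    (hπ : FiniteSecondMoment π) (c : ℝ≥0) (m₁ m₂ : Space d) {S₁ S₂ : Matrix (Fin d) (Fin d) ℝ}
    (hS₁ : S₁.PosDef) (hS₂ : S₂.PosDef) (h₁ : SameMoments π.fst (scaledGaussian c m₁ S₁))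
    (h₂ : SameMoments π.snd (scaledGaussian c m₂ S₂)) :
    ∫⁻ p, ‖p.2 - p.1‖ₑ ^ 2 ∂(affineGaussianCoupling c m₁ S₁ m₂ S₂) ≤
      ∫⁻ p, ‖p.2 - p.1‖ₑ ^ 2 ∂π := by
  have hcost : ∀ ρ : Measure (Space d × Space d), FiniteSecondMoment ρ →
      Integrable (fun p => ‖p.2 - p.1‖ ^ 2) ρ ∧
      ∫⁻ p, ‖p.2 - p.1‖ₑ ^ 2 ∂ρ = ENNReal.ofReal (∫ p, ‖p.2 - p.1‖ ^ 2 ∂ρ) := fun ρ hρ => by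
    have hsnd : MemLp (fun p : Space d × Space d => p.2) 2 ρ :=
      hρ.memLp.mono (by fun_prop) (ae_of_all _ fun p => norm_snd_le p)
    have hfst : MemLp (fun p : Space d × Space d => p.1) 2 ρ :=
      hρ.memLp.mono (by fun_prop) (ae_of_all _ fun p => norm_fst_le p)
    have hi : Integrable (fun p : Space d × Space d => ‖p.2 - p.1‖ ^ 2) ρ :=
      (hsnd.sub hfst).integrable_norm_pow two_ne_zero
    refine ⟨hi, ?_⟩
    rw [ofReal_integral_eq_lintegral_ofReal hi (ae_of_all _ fun p => by positivity)]
    refine lintegral_congr fun p => ?_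
    rw [ENNReal.ofReal_pow (norm_nonneg _), ofReal_norm]
  have := hπ.finite
  have hG := finiteSecondMoment_affineGaussianCoupling c m₁ m₂ S₁ S₂
  have hGfst := affineGaussianCoupling_fst c m₁ m₂ S₁ S₂
  have hGsnd := affineGaussianCoupling_snd c m₁ m₂ hS₁ hS₂.posSemidef
  obtain ⟨φ, ψ, hφm, hψm, hle, heq, hint⟩ := exists_quadratic_potentials m₁ m₂ hS₁ hS₂
  have hφ := (hint _ _ inferInstance inferInstance h₁).1
  have hψ := (hint _ _ inferInstance inferInstance h₂).2
  set πG := affineGaussianCoupling c m₁ S₁ m₂ S₂ with hπG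
  have hsplit : ∀ ρ : Measure (Space d × Space d), Integrable φ ρ.fst → Integrable ψ ρ.snd →
      Integrable (fun p => φ p.1 + ψ p.2) ρ ∧
        ∫ p, (φ p.1 + ψ p.2) ∂ρ = ∫ x, φ x ∂ρ.fst + ∫ y, ψ y ∂ρ.snd := fun ρ h1 h2 => by
    have e1 := h1.comp_measurable measurable_fst
    have e2 := h2.comp_measurable measurable_snd
    refine ⟨e1.add e2, ?_⟩
    rw [Measure.fst, Measure.snd, integral_map measurable_fst.aemeasurable h1.1,
      integral_map measurable_snd.aemeasurable h2.1]
    exact integral_add e1 e2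
  rw [(hcost _ hG).2, (hcost _ hπ).2]
  apply ENNReal.ofReal_le_ofReal
  calc ∫ p, ‖p.2 - p.1‖ ^ 2 ∂πG = ∫ p, (φ p.1 + ψ p.2) ∂πG := by
        refine integral_congr_ae ?_
        rw [hπG, affineGaussianCoupling]
        exact (ae_map_iff (by fun_prop) (measurableSet_eq_fun (by fun_prop) (by fun_prop))).2
          (ae_of_all _ fun x => (heq x).symm)
    _ = ∫ x, φ x ∂πG.fst + ∫ y, ψ y ∂πG.snd :=
        (hsplit _ (hGfst ▸ hφ.right) (hGsnd ▸ hψ.right)).2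
    _ = ∫ x, φ x ∂π.fst + ∫ y, ψ y ∂π.snd := by rw [hGfst, hGsnd, hφ.eq, hψ.eq]
    _ = ∫ p, (φ p.1 + ψ p.2) ∂π := (hsplit _ hφ.left hψ.left).2.symm
    _ ≤ ∫ p, ‖p.2 - p.1‖ ^ 2 ∂π :=
        integral_mono (hsplit _ hφ.left hψ.left).1 (hcost _ hπ).1 fun p => hle p.1 p.2

/-! ### Plans of finite cost -/

theorem scaledGaussian_absolutelyContinuous {d : ℕ} {c : ℝ≥0} (hc : 0 < c) (m : Space d)
    {S : Matrix (Fin d) (Fin d) ℝ} (hS : S.PosDef) : scaledGaussian c m S ≪ volume := by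
  obtain ⟨k, L, b, h⟩ := scaledGaussian_eq_withDensity hc m hS
  exact h ▸ withDensity_absolutelyContinuous _ _

theorem absolutelyContinuous_of_uotObjective_ne_top {d : ℕ} {γ : ℝ≥0} (hγ : 0 < γ)
    {α β : Measure (Space d)} {π : Measure (Space d × Space d)}
    (h : uotObjective γ α β π ≠ ∞) : π.fst ≪ α ∧ π.snd ≪ β := by
  have hγ' : (γ : ℝ≥0∞) ≠ 0 := by simpa using hγ.ne'
  rw [uotObjective, ENNReal.add_ne_top, ENNReal.add_ne_top] at h
  obtain ⟨⟨-, h1⟩, h2⟩ := h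
  exact ⟨(klDiv_ne_top_iff.1 fun h => h1 (by rw [h, ENNReal.mul_top hγ'])).1,
    (klDiv_ne_top_iff.1 fun h => h2 (by rw [h, ENNReal.mul_top hγ'])).1⟩

end GaussianUOT

theorem mainTheorem1 {d : ℕ}
    -- the reference measures `α = cα 𝒩(mα, Sα)`, `β = cβ 𝒩(mβ, Sβ)` and the penalty `γ`
    (cα cβ γ : ℝ≥0) (hcα : 0 < cα) (hcβ : 0 < cβ) (hγ : 0 < γ)
    (mα mβ : GaussianUOT.Space d) (Sα Sβ : Matrix (Fin d) (Fin d) ℝ)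
    (hSα : Sα.PosDef) (hSβ : Sβ.PosDef)
    -- a feasible plan of mass `c > 0`
    (π : Measure (GaussianUOT.Space d × GaussianUOT.Space d))
    (hπ : GaussianUOT.FiniteSecondMoment π)
    (c : ℝ≥0) (hc : 0 < c) (hmass : π Set.univ = c)
    -- means and covariances of its normalized marginals
    (m₁ m₂ : GaussianUOT.Space d) (S₁ S₂ : Matrix (Fin d) (Fin d) ℝ)
    (hm₁ : m₁ = GaussianUOT.meanVec (GaussianUOT.normalized π.fst))
    (hm₂ : m₂ = GaussianUOT.meanVec (GaussianUOT.normalized π.snd))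
    (hS₁ : S₁ = GaussianUOT.covMatrix (GaussianUOT.normalized π.fst))
    (hS₂ : S₂ = GaussianUOT.covMatrix (GaussianUOT.normalized π.snd))
    (α β : Measure (GaussianUOT.Space d))
    (hα : α = GaussianUOT.scaledGaussian cα mα Sα)
    (hβ : β = GaussianUOT.scaledGaussian cβ mβ Sβ)
    (πG : Measure (GaussianUOT.Space d × GaussianUOT.Space d))
    (hπG : πG = GaussianUOT.affineGaussianCoupling c m₁ S₁ m₂ S₂) :
    -- plans of finite cost have nonsingular covariances, so the affine map is well defined
    (GaussianUOT.uotObjective γ α β π ≠ ∞ → S₁.PosDef ∧ S₂.PosDef) ∧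
    -- `πG` is a feasible plan coupling the two Gaussian measures
    (S₁.PosDef → GaussianUOT.FiniteSecondMoment πG ∧
      πG.fst = GaussianUOT.scaledGaussian c m₁ S₁ ∧
      πG.snd = GaussianUOT.scaledGaussian c m₂ S₂) ∧
    -- optimality
    GaussianUOT.uotObjective γ α β πG ≤ GaussianUOT.uotObjective γ α β π ∧
    -- equality case
    (π.fst = GaussianUOT.scaledGaussian c m₁ S₁ → π.snd = GaussianUOT.scaledGaussian c m₂ S₂ →
      π = πG → GaussianUOT.uotObjective γ α β πG = GaussianUOT.uotObjective γ α β π) := by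
  have hfst_mass : π.fst Set.univ = c := by rw [Measure.fst_univ, hmass]
  have hsnd_mass : π.snd Set.univ = c := by rw [Measure.snd_univ, hmass]
  have hfin := hπ.finite
  have h₁ := GaussianUOT.sameMoments_scaledGaussian hπ.fst hc hfst_mass
  have h₂ := GaussianUOT.sameMoments_scaledGaussian hπ.snd hc hsnd_mass
  have hpsd₂ : S₂.PosSemidef := by
    have := GaussianUOT.isProbabilityMeasure_normalized hc hsnd_mass
    exact hS₂ ▸ GaussianUOT.covMatrix_posSemidef (hπ.snd.memLp_normalized hc hsnd_mass)
  rw [← hm₁, ← hS₁] at h₁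
  rw [← hm₂, ← hS₂] at h₂
  have hposDef : GaussianUOT.uotObjective γ α β π ≠ ∞ → S₁.PosDef ∧ S₂.PosDef := fun h => by
    obtain ⟨hac₁, hac₂⟩ := GaussianUOT.absolutelyContinuous_of_uotObjective_ne_top hγ h
    subst hα hβ
    rw [hS₁, hS₂]
    exact ⟨GaussianUOT.covMatrix_posDef_of_absolutelyContinuous hπ.fst hc hfst_mass
        (hac₁.trans (GaussianUOT.scaledGaussian_absolutelyContinuous hcα mα hSα)),
      GaussianUOT.covMatrix_posDef_of_absolutelyContinuous hπ.snd hc hsnd_mass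
        (hac₂.trans (GaussianUOT.scaledGaussian_absolutelyContinuous hcβ mβ hSβ))⟩
  refine ⟨hposDef, fun hS => ?_, ?_, fun _ _ h => by rw [← h]⟩
  · subst hπG
    exact ⟨GaussianUOT.finiteSecondMoment_affineGaussianCoupling c m₁ m₂ S₁ S₂,
      GaussianUOT.affineGaussianCoupling_fst c m₁ m₂ S₁ S₂,
      GaussianUOT.affineGaussianCoupling_snd c m₁ m₂ hS hpsd₂⟩
  · by_cases hJ : GaussianUOT.uotObjective γ α β π = ∞
    · simp [hJ]
    obtain ⟨hpd₁, hpd₂⟩ := hposDef hJ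
    subst hπG hα hβ
    unfold GaussianUOT.uotObjective
    rw [GaussianUOT.affineGaussianCoupling_fst,
      GaussianUOT.affineGaussianCoupling_snd c m₁ m₂ hpd₁ hpsd₂]
    -- the transport cost and both divergences decrease separately
    gcongr ?_ + _ * ?_ + _ * ?_
    · exact GaussianUOT.lintegral_cost_affineGaussianCoupling_le hπ c m₁ m₂ hpd₁ hpd₂ h₁ h₂
    · exact GaussianUOT.klDiv_scaledGaussian_le hc hcα hpd₁ hSα h₁
    · exact GaussianUOT.klDiv_scaledGaussian_le hc hcβ hpd₂ hSβ h₂
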